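/- **Setting.** Let $\mathcal X\subseteq\mathbb R^{n_x}$, $\mathcal U\subseteq\mathbb R^{n_u}$, $\Xi\subseteq\mathbb R^{n_\xi}$, let $g:\mathcal X\times\mathcal U\times\Xi\to\mathcal X$ and $l:\mathcal X\times\mathcal U\to[0,\infty)$ be Borel measurable, let $\gamma\in[0,1)$, and let $\xi_0,\xi_1,\dots$ be i.i.d. $\Xi$-valued random variables. For $x\in\mathcal X$ let $$V^*(x)=\inf_{\pi}\ \mathbb E\Big[\sum_{t=0}^\infty\gamma^t\,l(x_t,\pi(x_t))\Big],\qquad x_0=x,\quad x_{t+1}=g(x_t,\pi(x_t),\xi_t),$$ the infimum being over the measurable maps $\pi:\mathcal X\to\mathcal U$, and assume that $V^*(x)<\infty$ for all $x\in\mathcal X$. Put $(\mathcal T_uV)(x,u)=l(x,u)+\gamma\,\mathbb E[V(g(x,u,\xi))]$, with $\xi$ distributed as $\xi_0$. Let $\phi=(\phi_1,\dots,\phi_K):\mathcal X\to\mathbb R^K$ be continuous, one of the $\phi_k$ being the constant function $1$, with $\phi(g(x,u,\xi))$ integrable for all $x,u$. For a finite non-empty $A\subset\mathbb R^K$ let $V_A(x)=\max_{\alpha\in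 A}\alpha^\top\phi(x)$, and let $BI(A)\subseteq\mathbb R^K$ be a convex set such that every $\alpha\in BI(A)$ satisfies $\alpha^\top\phi(x)\le(\mathcal T_uV_A)(x,u)$ for all $x\in\mathcal X$, $u\in\mathcal U$. Let $x_{c,1},\dots,x_{c,N_c}\in\mathcal X$ with $N_c\ge1$. For a finite non-empty set $\mathcal A_{\rm obj}\subset\mathbb R^K$ put $$F(\mathcal A_{\rm obj})=\frac1{N_c}\sum_{i=1}^{N_c}V_{\mathcal A_{\rm obj}}(x_{c,i}),\qquad f_{\rm pwm}(\alpha)=\frac1{N_c}\sum_{i=1}^{N_c}\max\{\alpha^\top\phi(x_{c,i}),V_{\mathcal A_{\rm obj}}(x_{c,i})\}.$$ Let $\partial^+f=-\partial(-f)$ denote the general (limiting) upper subdifferential. *Algorithm 1*, with input $\alpha^{(0)},\mathcal A_{\rm obj},\mathcal A_{\rm con},\epsilon$: starting from $k=0$, choose any $d^{(k)}\in\partial^+f_{\rm pwm}(\alpha^{(k)})$; put $\alpha^{(k+1)}=\alpha^{(k)}$ if $d^{(k)}=0$, and otherwise let $\alpha^{(k+1)}$ be any maximizer of $\alpha^\top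 d^{(k)}$ over $\alpha\in BI(\mathcal A_{\rm con})$; increase $k$ by one; repeat until $f_{\rm pwm}(\alpha^{(k)})-f_{\rm pwm}(\alpha^{(k-1)})<\epsilon$, and return $\alpha^{(k)}$. *Algorithm 2*, with input $\mathcal A_{\rm obj},\mathcal A_{\rm con},\epsilon_{\rm IN},\epsilon_{\rm OUT}$: starting from $m=0$, put $f^{(m)}=F(\mathcal A_{\rm obj})$; for $i=1,\dots,N_c$ in turn, choose any maximizer $\alpha^{(0)}$ of $\alpha^\top\phi(x_{c,i})$ over $\alpha\in BI(\mathcal A_{\rm con})$, refine it by Algorithm 1 with the current sets and tolerance $\epsilon_{\rm IN}$ to $\tilde\alpha$, and add $\tilde\alpha$ to both $\mathcal A_{\rm obj}$ and $\mathcal A_{\rm con}$; then increase $m$ by one and put $f^{(m)}=F(\mathcal A_{\rm obj})$; repeat until $f^{(m)}-f^{(m-1)}<\epsilon_{\rm OUT}$, and return $\mathcal A_{\rm obj},\mathcal A_{\rm con}$. **Theorem.** Let $\epsilon_{\rm IN},\epsilon_{\rm OUT}>0$, and let the initial sets $\mathcal A_{\rm obj},\mathcal A_{\rm con}\subset\mathbb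 R^K$ be finite and non-empty with $V_{\mathcal A_{\rm obj}}\le V^*$ and $V_{\mathcal A_{\rm con}}\le V^*$ on $\mathcal X$. Assume that for every finite $A\supseteq\mathcal A_{\rm con}$ with $V_A\le V^*$ and every $i$ the problem $\max\{\alpha^\top\phi(x_{c,i}):\alpha\in BI(A)\}$ attains its maximum. Then, whatever choices are made: 1. Algorithm 2 stops after finitely many iterations: no execution of it, including the inner loops of Algorithm 1, is infinite. 2. Throughout every execution $F(\mathcal A_{\rm obj})$ is non-decreasing and at most $\frac1{N_c}\sum_{i=1}^{N_c}V^*(x_{c,i})$. 3. An execution can stop only by returning, or at a step of Algorithm 1 with $d^{(k)}\neq0$ at which $\alpha^\top d^{(k)}$ has no maximizer over $BI(\mathcal A_{\rm con})$. If, moreover, for all $A$ as above and all non-empty $I\subseteq\{1,\dots,N_c\}$ the problem $\max\{\sum_{i\in I}\alpha^\top\phi(x_{c,i}):\alpha\in BI(A)\}$ attains its maximum, then an execution can stop only by returning, so that Algorithm 2 always terminates and returns after finitely many iterations. -/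

import Mathlib

open MeasureTheory Filter Topology
open scoped ENNReal

noncomputable section

namespace PwmADP

/-! ### Stochastic optimal control problem -/

/-- Data of a discounted infinite-horizon stochastic optimal control problem with state set
`X ⊆ ℝ^nx`, action set `U ⊆ ℝ^nu`, disturbance set `Ξ ⊆ ℝ^nξ`, dynamics `g`, non-negative
stage cost `l`, discount factor `γ ∈ [0,1)`; the disturbances are i.i.d. with law `P`. -/
structure ControlProblem (nx nu nξ : ℕ) where
  X : Set (EuclideanSpace ℝ (Fin nx))
  U : Set (EuclideanSpace ℝ (Fin nu))
  Ξ : Set (EuclideanSpace ℝ (Fin nξ))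
  g : X → U → Ξ → X
  l : X → U → ℝ
  γ : ℝ
  P : Measure Ξ
  measurable_g : Measurable fun p : X × U × Ξ => g p.1 p.2.1 p.2.2
  measurable_l : Measurable fun p : X × U => l p.1 p.2
  l_nonneg : ∀ x u, 0 ≤ l x u
  γ_nonneg : 0 ≤ γ
  γ_lt_one : γ < 1
  isProb : IsProbabilityMeasure P

attribute [instance] ControlProblem.isProb

namespace ControlProblem

variable {nx nu nξ : ℕ} (M : ControlProblem nx nu nξ)

/-- State at time `t` under the policy `π` from `x`, for the disturbance sequence `ω`. -/
def traj (π : M.X → M.U) (x : M.X) (ω : ℕ → M.Ξ) : ℕ → M.X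
  | 0 => x
  | t + 1 => M.g (traj π x ω t) (π (traj π x ω t)) (ω t)

/-- Expected discounted cost of the policy `π` from `x`. The disturbance sequence is drawn from
the infinite product of `P`; the summands are non-negative, so the value lies in `[0,∞]`. -/
def cost (π : M.X → M.U) (x : M.X) : ℝ≥0∞ :=
  ∫⁻ ω, ∑' t : ℕ, ENNReal.ofReal (M.γ ^ t * M.l (M.traj π x ω t) (π (M.traj π x ω t)))
    ∂(Measure.infinitePi fun _ : ℕ => M.P)

/-- Infimum of the cost over the (measurable) deterministic Markov policies, in `[0,∞]`. -/
def optCost (x : M.X) : ℝ≥0∞ :=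
  ⨅ π : {π : M.X → M.U // Measurable π}, M.cost π.1 x

/-- The real-valued optimal value function; used only where `optCost` is finite. -/
def Vstar (x : M.X) : ℝ := (M.optCost x).toReal

/-- `(T_u V)(x,u) = l(x,u) + γ E[V(g(x,u,ξ))]`. -/
def bellman (V : M.X → ℝ) (x : M.X) (u : M.U) : ℝ :=
  M.l x u + M.γ * ∫ ξ, V (M.g x u ξ) ∂M.P

end ControlProblem

/-! ### Upper subdifferential -/

section Subdiff

variable {E : Type*} [NormedAddCommGroup E] [InnerProductSpace ℝ E]

/-- `d` is a regular lower subgradient of `f` at `x`: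
`liminf_{z → x, z ≠ x} (f z - f x - ⟨z - x, d⟩) / ‖z - x‖ ≥ 0`. -/
def IsRegularSubgradient (f : E → ℝ) (x d : E) : Prop :=
  ∀ ε : ℝ, 0 < ε → ∀ᶠ z in 𝓝[≠] x, -ε ≤ (f z - f x - inner ℝ (z - x) d) / ‖z - x‖

/-- The general lower subdifferential: limits of regular subgradients along `f`-attentive
sequences. -/
def lowerSubdiff (f : E → ℝ) (x : E) : Set E :=
  {d | ∃ y e : ℕ → E, Tendsto y atTop (𝓝 x) ∧ Tendsto (fun n => f (y n)) atTop (𝓝 (f x)) ∧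
    (∀ n, IsRegularSubgradient f (y n) (e n)) ∧ Tendsto e atTop (𝓝 d)}

/-- The general upper subdifferential `∂⁺ f (x) = -∂(-f)(x)`. -/
def upperSubdiff (f : E → ℝ) (x : E) : Set E :=
  {d | -d ∈ lowerSubdiff (fun y => -f y) x}

/-- `α` maximizes the linear functional `⟨·, d⟩` over `C`. -/
def IsLPMax (C : Set E) (d α : E) : Prop :=
  α ∈ C ∧ ∀ β ∈ C, inner ℝ β d ≤ inner ℝ α d

end Subdiff

/-! ### Point-wise maxima, and the two algorithms -/

section Algorithm

variable {X : Type*} {K N : ℕ}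

/-- Point-wise maximum `x ↦ max_{α ∈ A} αᵀ φ(x)`, for finite non-empty `A`. -/
def pwm (φ : X → EuclideanSpace ℝ (Fin K)) (A : Set (EuclideanSpace ℝ (Fin K))) (x : X) : ℝ :=
  sSup ((fun α => inner ℝ α (φ x)) '' A)

/-- `(1/N) ∑ᵢ max_{α ∈ A} αᵀ φ(xcᵢ)`. -/
def avgObj (φ : X → EuclideanSpace ℝ (Fin K)) (xc : Fin N → X)
    (A : Set (EuclideanSpace ℝ (Fin K))) : ℝ :=
  (1 / (N : ℝ)) * ∑ i, pwm φ A (xc i)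

/-- `f_pwm(α) = (1/N) ∑ᵢ max {αᵀ φ(xcᵢ), V_obj(xcᵢ)}`. -/
def fpwm (φ : X → EuclideanSpace ℝ (Fin K)) (xc : Fin N → X)
    (Aobj : Set (EuclideanSpace ℝ (Fin K))) (α : EuclideanSpace ℝ (Fin K)) : ℝ :=
  (1 / (N : ℝ)) * ∑ i, max (inner ℝ α (φ (xc i))) (pwm φ Aobj (xc i))

/-- Control points of the outer algorithm (with the inner procedure in-lined), together with the
current values of the program variables. -/
inductive State (K : ℕ)
  /-- Top of the outer repeat loop, iteration `m`. -/
  | outer (m : ℕ) (Aobj Acon : Set (EuclideanSpace ℝ (Fin K)))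
  /-- Top of the loop over the samples, at sample `i`; `fm` is the stored objective `f⁽ᵐ⁾`. -/
  | sample (m : ℕ) (fm : ℝ) (i : ℕ) (Aobj Acon : Set (EuclideanSpace ℝ (Fin K)))
  /-- Top of the inner repeat loop, iterate `α⁽ᵏ⁾ = α`. -/
  | inner (m : ℕ) (fm : ℝ) (i : ℕ) (Aobj Acon : Set (EuclideanSpace ℝ (Fin K)))
      (k : ℕ) (α : EuclideanSpace ℝ (Fin K))
  /-- Inner loop, after the subgradient `d⁽ᵏ⁾ = d` has been selected. -/
  | update (m : ℕ) (fm : ℝ) (i : ℕ) (Aobj Acon : Set (EuclideanSpace ℝ (Fin K)))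
      (k : ℕ) (α d : EuclideanSpace ℝ (Fin K))
  /-- The outer algorithm has returned. -/
  | returned (Aobj Acon : Set (EuclideanSpace ℝ (Fin K)))

/-- The current objective family `A_obj` of a state. -/
def State.Aobj : State K → Set (EuclideanSpace ℝ (Fin K))
  | .outer _ A _ => A
  | .sample _ _ _ A _ => A
  | .inner _ _ _ A _ _ _ => A
  | .update _ _ _ A _ _ _ _ => A
  | .returned A _ => A

/-- The next inner iterate: `α⁽ᵏ⁺¹⁾ = α⁽ᵏ⁾` if `d⁽ᵏ⁾ = 0`, else any maximizer of `αᵀ d⁽ᵏ⁾`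
over `C`. -/
def InnerUpdate (C : Set (EuclideanSpace ℝ (Fin K))) (α d α' : EuclideanSpace ℝ (Fin K)) : Prop :=
  (d = 0 ∧ α' = α) ∨ (d ≠ 0 ∧ IsLPMax C d α')

/-- One step of the outer algorithm. It is non-deterministic: any maximizer and any element of the
upper subdifferential may be selected. -/
inductive Step (φ : X → EuclideanSpace ℝ (Fin K)) (xc : Fin N → X)
    (BI : Set (EuclideanSpace ℝ (Fin K)) → Set (EuclideanSpace ℝ (Fin K))) (εin εout : ℝ) :
    State K → State K → Prop
  | start (m : ℕ) (Ao Ac : Set (EuclideanSpace ℝ (Fin K))) :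
      Step φ xc BI εin εout (.outer m Ao Ac) (.sample m (avgObj φ xc Ao) 0 Ao Ac)
  | generate (m : ℕ) (fm : ℝ) (i : ℕ) (Ao Ac : Set (EuclideanSpace ℝ (Fin K)))
      (α : EuclideanSpace ℝ (Fin K)) (hi : i < N)
      (hα : IsLPMax (BI Ac) (φ (xc ⟨i, hi⟩)) α) :
      Step φ xc BI εin εout (.sample m fm i Ao Ac) (.inner m fm i Ao Ac 0 α)
  | subgradient (m : ℕ) (fm : ℝ) (i : ℕ) (Ao Ac : Set (EuclideanSpace ℝ (Fin K)))
      (k : ℕ) (α d : EuclideanSpace ℝ (Fin K)) (hd : d ∈ upperSubdiff (fpwm φ xc Ao) α) :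
      Step φ xc BI εin εout (.inner m fm i Ao Ac k α) (.update m fm i Ao Ac k α d)
  | innerRepeat (m : ℕ) (fm : ℝ) (i : ℕ) (Ao Ac : Set (EuclideanSpace ℝ (Fin K)))
      (k : ℕ) (α d α' : EuclideanSpace ℝ (Fin K)) (hα : InnerUpdate (BI Ac) α d α')
      (hε : ¬ fpwm φ xc Ao α' - fpwm φ xc Ao α < εin) :
      Step φ xc BI εin εout (.update m fm i Ao Ac k α d) (.inner m fm i Ao Ac (k + 1) α')
  | innerReturn (m : ℕ) (fm : ℝ) (i : ℕ) (Ao Ac : Set (EuclideanSpace ℝ (Fin K)))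
      (k : ℕ) (α d α' : EuclideanSpace ℝ (Fin K)) (hα : InnerUpdate (BI Ac) α d α')
      (hε : fpwm φ xc Ao α' - fpwm φ xc Ao α < εin) :
      Step φ xc BI εin εout (.update m fm i Ao Ac k α d)
        (.sample m fm (i + 1) (insert α' Ao) (insert α' Ac))
  | outerRepeat (m : ℕ) (fm : ℝ) (Ao Ac : Set (EuclideanSpace ℝ (Fin K)))
      (hε : ¬ avgObj φ xc Ao - fm < εout) :
      Step φ xc BI εin εout (.sample m fm N Ao Ac) (.outer (m + 1) Ao Ac)
  | outerReturn (m : ℕ) (fm : ℝ) (Ao Ac : Set (EuclideanSpace ℝ (Fin K)))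
      (hε : avgObj φ xc Ao - fm < εout) :
      Step φ xc BI εin εout (.sample m fm N Ao Ac) (.returned Ao Ac)

/-- States that can be reached from the initial families. -/
def Reachable (φ : X → EuclideanSpace ℝ (Fin K)) (xc : Fin N → X)
    (BI : Set (EuclideanSpace ℝ (Fin K)) → Set (EuclideanSpace ℝ (Fin K))) (εin εout : ℝ)
    (Aobj Acon : Set (EuclideanSpace ℝ (Fin K))) (s : State K) : Prop :=
  Relation.ReflTransGen (Step φ xc BI εin εout) (.outer 0 Aobj Acon) s

end Algorithm

/-- `BI` assigns to each finite non-empty family `A` a convex inner approximation of the set of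
`α` with `αᵀ φ(x) ≤ (T_u V_A)(x,u)` for all `x`, `u`, where `V_A` is the point-wise maximum. -/
structure IsConvexInnerApprox {nx nu nξ K : ℕ} (M : ControlProblem nx nu nξ)
    (φ : M.X → EuclideanSpace ℝ (Fin K))
    (BI : Set (EuclideanSpace ℝ (Fin K)) → Set (EuclideanSpace ℝ (Fin K))) : Prop where
  convex : ∀ A : Set (EuclideanSpace ℝ (Fin K)), A.Finite → A.Nonempty → Convex ℝ (BI A)
  bellman_ineq : ∀ A : Set (EuclideanSpace ℝ (Fin K)), A.Finite → A.Nonempty → ∀ α ∈ BI A,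
    ∀ x u, inner ℝ α (φ x) ≤ M.bellman (pwm φ A) x u

end PwmADP

end

/-! The key fact: if `V_A ≤ V*`, then every `α ∈ BI A` satisfies `αᵀφ ≤ V*`. It is proved one policy
at a time. The cost of `π` solves its own Bellman equation (`cost_eq`) and dominates `V*`, so
`αᵀφ(x) ≤ (T_u V_A)(x, π x) ≤ cost π x`, and the infimum over `π` gives the claim
(`le_Vstar_of_le_bellman`). No Bellman equation for `V*` and no measurable selection is needed.

Hence both families always stay below `V*`, and `avgObj` and `fpwm` never exceed the sample average
of `V*`. Every repetition of an inner or outer loop gains at least `εin` or `εout`, so a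
lexicographic rank decreases at each step (`rank_lt`). Termination does not depend on which
subgradients are chosen.

For progress, `fpwm` is convex and piecewise affine, and its regular upper subgradients are
gradients of affine pieces. Moving `α` along the coordinate of the constant basis function breaks
all ties, so the upper subdifferential is non-empty (`sampleGrad_activeSet_mem_upperSubdiff`).
Conversely, each of its elements is `1/N` times a sum of `φ(xcᵢ)` over some index set
(`exists_eq_sampleGrad_of_mem_upperSubdiff`), so attainment for such sums excludes blocking. -/

noncomputable section

namespace PwmADP

/-! ### Prepending a disturbance to an i.i.d. sequence -/

section Cons

variable {α : Type*}

/-- The sequence with head `a` and tail `ω`. -/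
def seqCons (a : α) (ω : ℕ → α) : ℕ → α
  | 0 => a
  | n + 1 => ω n

variable [MeasurableSpace α]

lemma measurable_seqCons : Measurable fun p : α × (ℕ → α) => seqCons p.1 p.2 := by
  refine measurable_pi_lambda _ fun n => ?_
  cases n with
  | zero => exact measurable_fst
  | succ n => exact (measurable_pi_apply n).comp measurable_snd

/-- The time-shift invariance behind `cost_eq`: it suffices to compare boxes, and the preimage of a
box splits into its side at `0` and the shifted box. -/
lemma map_seqCons_prod_infinitePi (P : Measure α) [IsProbabilityMeasure P] :
    (P.prod (Measure.infinitePi fun _ : ℕ => P)).map (fun p => seqCons p.1 p.2) =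
      Measure.infinitePi fun _ : ℕ => P := by
  classical
  refine Measure.eq_infinitePi _ fun s t ht => ?_
  obtain ⟨n, hn⟩ : ∃ n, s ⊆ Finset.range (n + 1) := by
    obtain ⟨n, hn⟩ := s.exists_nat_subset_range
    exact ⟨n, hn.trans (Finset.range_mono n.le_succ)⟩
  -- Padding with `univ` makes the box range over the initial segment `0, …, n`, which always
  -- contains the coordinate `0` to be split off.
  let t' : ℕ → Set α := fun i => if i ∈ s then t i else Set.univ
  have ht' : ∀ i, MeasurableSet (t' i) := fun i => by
    by_cases hi : i ∈ s
    · simp only [t', hi, if_true, ht i]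
    · simp only [t', hi, if_false, MeasurableSet.univ]
  have hpre : (fun p : α × (ℕ → α) => seqCons p.1 p.2) ⁻¹' (Set.pi s t) =
      t' 0 ×ˢ Set.pi (Finset.range n) (fun i => t' (i + 1)) := by
    ext ⟨a, ω⟩
    have hbox : seqCons a ω ∈ Set.pi (s : Set ℕ) t ↔
        ∀ i < n + 1, seqCons a ω i ∈ t' i := by
      simp only [Set.mem_pi, Finset.mem_coe]
      refine ⟨fun h i _ => ?_, fun h i hi => ?_⟩
      · by_cases his : i ∈ s
        · simpa only [t', his, if_true] using h i his
        · simp only [t', his, if_false, Set.mem_univ]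
      · simpa only [t', hi, if_true] using h i (Finset.mem_range.1 (hn hi))
    rw [Set.mem_preimage, hbox]
    simp only [Set.mem_prod, Set.mem_pi, Finset.mem_coe, Finset.mem_range]
    refine ⟨fun h => ⟨h 0 n.succ_pos, fun i hi => h (i + 1) (Nat.succ_lt_succ hi)⟩, ?_⟩
    rintro ⟨h0, h⟩ i hi
    cases i with
    | zero => exact h0
    | succ i => exact h i (Nat.lt_of_succ_lt_succ hi)
  rw [Measure.map_apply measurable_seqCons
    (MeasurableSet.pi s.countable_toSet fun i _ => ht i), hpre, Measure.prod_prod,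
    Measure.infinitePi_pi _ (fun i _ => ht' _), mul_comm,
    ← Finset.prod_range_succ' (fun i => P (t' i)) n]
  symm
  refine (Finset.prod_congr rfl fun i hi => ?_).trans (Finset.prod_subset hn fun i _ hi => ?_)
  · simp only [t', hi, if_true]
  · simp only [t', hi, if_false, measure_univ]

end Cons

/-! ### Policy evaluation -/

namespace ControlProblem

variable {nx nu nξ : ℕ} (M : ControlProblem nx nu nξ)

lemma traj_seqCons (π : M.X → M.U) (x : M.X) (ξ : M.Ξ) (ω : ℕ → M.Ξ) (t : ℕ) :
    M.traj π x (seqCons ξ ω) (t + 1) = M.traj π (M.g x (π x) ξ) ω t := by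
  induction t with
  | zero => rfl
  | succ t ih => rw [traj, ih]; rfl

variable {M} in
lemma measurable_traj {π : M.X → M.U} (hπ : Measurable π) (t : ℕ) :
    Measurable fun p : M.X × (ℕ → M.Ξ) => M.traj π p.1 p.2 t := by
  induction t with
  | zero => exact measurable_fst
  | succ t ih =>
    exact M.measurable_g.comp
      (ih.prodMk ((hπ.comp ih).prodMk ((measurable_pi_apply t).comp measurable_snd)))

/-- Discounted cost of the policy `π` from `x` along the disturbance sequence `ω`. -/
def pathCost (π : M.X → M.U) (x : M.X) (ω : ℕ → M.Ξ) : ℝ≥0∞ :=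
  ∑' t : ℕ, ENNReal.ofReal (M.γ ^ t * M.l (M.traj π x ω t) (π (M.traj π x ω t)))

lemma pathCost_seqCons (π : M.X → M.U) (x : M.X) (ξ : M.Ξ) (ω : ℕ → M.Ξ) :
    M.pathCost π x (seqCons ξ ω) =
      ENNReal.ofReal (M.l x (π x)) +
        ENNReal.ofReal M.γ * M.pathCost π (M.g x (π x) ξ) ω := by
  rw [pathCost, tsum_eq_zero_add' ENNReal.summable, pathCost, ← ENNReal.tsum_mul_left]
  · congr 1
    · simp [traj]
    · refine tsum_congr fun t => ?_
      rw [traj_seqCons, ← ENNReal.ofReal_mul M.γ_nonneg, pow_succ', mul_assoc]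

variable {M} in
lemma measurable_pathCost {π : M.X → M.U} (hπ : Measurable π) :
    Measurable fun p : M.X × (ℕ → M.Ξ) => M.pathCost π p.1 p.2 := by
  refine Measurable.tsum fun t => ENNReal.measurable_ofReal.comp ?_
  have h := measurable_traj hπ t
  exact measurable_const.mul (M.measurable_l.comp (h.prodMk (hπ.comp h)))

/-- The cost of a policy solves its Bellman equation. -/
lemma cost_eq {π : M.X → M.U} (hπ : Measurable π) (x : M.X) :
    M.cost π x = ENNReal.ofReal (M.l x (π x)) +
      ENNReal.ofReal M.γ * ∫⁻ ξ, M.cost π (M.g x (π x) ξ) ∂M.P := by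
  have hpath : ∀ y, Measurable (M.pathCost π y) := fun y =>
    (measurable_pathCost hπ).comp measurable_prodMk_left
  have hg : Measurable fun ξ => M.g x (π x) ξ :=
    M.measurable_g.comp (measurable_const.prodMk (measurable_const.prodMk measurable_id))
  have hnext : Measurable fun p : M.Ξ × (ℕ → M.Ξ) => M.pathCost π (M.g x (π x) p.1) p.2 :=
    (measurable_pathCost hπ).comp ((hg.comp measurable_fst).prodMk measurable_snd)
  change ∫⁻ ω, M.pathCost π x ω ∂_ = _
  rw [← map_seqCons_prod_infinitePi M.P, lintegral_map (hpath x) measurable_seqCons]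
  simp only [pathCost_seqCons]
  rw [lintegral_add_left measurable_const, lintegral_const_mul _ hnext, lintegral_const, measure_univ,
    mul_one, lintegral_prod _ hnext.aemeasurable]
  rfl

/-- The Bellman operator maps functions below the cost of a policy to functions below it. -/
lemma bellman_le_cost {π : M.X → M.U} (hπ : Measurable π) {V : M.X → ℝ} (x : M.X)
    (hV : ∀ y, ENNReal.ofReal (V y) ≤ M.cost π y)
    (hint : Integrable (fun ξ => V (M.g x (π x) ξ)) M.P) :
    ENNReal.ofReal (M.bellman V x (π x)) ≤ M.cost π x := by
  rw [M.cost_eq hπ, bellman]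
  refine ENNReal.ofReal_add_le.trans (add_le_add le_rfl ?_)
  rw [ENNReal.ofReal_mul M.γ_nonneg]
  refine mul_le_mul_right ?_ _
  -- `V` may be negative, so the positive part is taken before passing to a Lebesgue integral.
  calc ENNReal.ofReal (∫ ξ, V (M.g x (π x) ξ) ∂M.P)
      ≤ ENNReal.ofReal (∫ ξ, max (V (M.g x (π x) ξ)) 0 ∂M.P) :=
        ENNReal.ofReal_le_ofReal (integral_mono hint hint.pos_part fun ξ => le_max_left _ _)
    _ = ∫⁻ ξ, ENNReal.ofReal (max (V (M.g x (π x) ξ)) 0) ∂M.P :=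
        ofReal_integral_eq_lintegral_ofReal hint.pos_part (ae_of_all _ fun ξ => le_max_right _ _)
    _ ≤ ∫⁻ ξ, M.cost π (M.g x (π x) ξ) ∂M.P := by
        refine lintegral_mono fun ξ => ?_
        simpa [ENNReal.ofReal_max] using hV (M.g x (π x) ξ)

/-- A real function dominated by the Bellman image of a lower bound of `V*` is itself a lower
bound of `V*`. -/
lemma le_Vstar_of_le_bellman (hfin : ∀ x, M.optCost x ≠ ⊤) {V W : M.X → ℝ}
    (hV : ∀ x, V x ≤ M.Vstar x) (hint : ∀ x u, Integrable (fun ξ => V (M.g x u ξ)) M.P)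
    (hW : ∀ x u, W x ≤ M.bellman V x u) (x : M.X) : W x ≤ M.Vstar x := by
  refine (ENNReal.ofReal_le_iff_le_toReal (hfin x)).1 (le_iInf fun π => ?_)
  refine (ENNReal.ofReal_le_ofReal (hW x (π.1 x))).trans
    (M.bellman_le_cost π.2 x (fun y => ?_) (hint _ _))
  exact ((ENNReal.ofReal_le_iff_le_toReal (hfin y)).2 (hV y)).trans (iInf_le _ π)

end ControlProblem

/-! ### Point-wise maxima -/

section Pwm

variable {X : Type*} {K N : ℕ} {φ : X → EuclideanSpace ℝ (Fin K)} {xc : Fin N → X}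
  {A B : Set (EuclideanSpace ℝ (Fin K))}

lemma inner_le_pwm (hA : A.Finite) {α : EuclideanSpace ℝ (Fin K)} (hα : α ∈ A) (x : X) :
    inner ℝ α (φ x) ≤ pwm φ A x :=
  le_csSup (hA.image _).bddAbove (Set.mem_image_of_mem _ hα)

lemma pwm_le (hA : A.Nonempty) {x : X} {c : ℝ} (h : ∀ α ∈ A, inner ℝ α (φ x) ≤ c) :
    pwm φ A x ≤ c :=
  csSup_le (hA.image _) (Set.forall_mem_image.2 h)

lemma pwm_mono (hA : A.Nonempty) (hB : B.Finite) (h : A ⊆ B) (x : X) :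
    pwm φ A x ≤ pwm φ B x :=
  pwm_le hA fun _ hα => inner_le_pwm hB (h hα) x

lemma pwm_insert_le (hA : A.Finite) {α : EuclideanSpace ℝ (Fin K)} {x : X} {c : ℝ}
    (hα : inner ℝ α (φ x) ≤ c) (hc : pwm φ A x ≤ c) : pwm φ (insert α A) x ≤ c :=
  pwm_le (Set.insert_nonempty _ _) <| Set.forall_mem_insert.2
    ⟨hα, fun _ hβ => (inner_le_pwm hA hβ x).trans hc⟩

lemma avgObj_mono (hA : A.Nonempty) (hB : B.Finite) (h : A ⊆ B) :
    avgObj φ xc A ≤ avgObj φ xc B :=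
  mul_le_mul_of_nonneg_left (Finset.sum_le_sum fun _ _ => pwm_mono hA hB h _) (by positivity)

lemma avgObj_le {V : X → ℝ} (h : ∀ x, pwm φ A x ≤ V x) :
    avgObj φ xc A ≤ (1 / (N : ℝ)) * ∑ i, V (xc i) :=
  mul_le_mul_of_nonneg_left (Finset.sum_le_sum fun _ _ => h _) (by positivity)

lemma fpwm_le {V : X → ℝ} (h : ∀ x, pwm φ A x ≤ V x) {α : EuclideanSpace ℝ (Fin K)}
    (hα : ∀ x, inner ℝ α (φ x) ≤ V x) :
    fpwm φ xc A α ≤ (1 / (N : ℝ)) * ∑ i, V (xc i) :=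
  mul_le_mul_of_nonneg_left (Finset.sum_le_sum fun _ _ => max_le (hα _) (h _)) (by positivity)

lemma integrable_pwm {Ω : Type*} [MeasurableSpace Ω] {μ : Measure Ω} {f : Ω → X}
    (hf : Integrable (fun ω => φ (f ω)) μ) (hA : A.Finite) (hne : A.Nonempty) :
    Integrable (fun ω => pwm φ A (f ω)) μ := by
  induction A, hA using Set.Finite.induction_on with
  | empty => exact absurd hne Set.not_nonempty_empty
  | @insert a s _ hs ih =>
    have ha : Integrable (fun ω => inner ℝ a (φ (f ω))) μ := hf.const_inner a
    -- `pwm` of the empty family is the default `0`, which is not neutral for `max`, so singletons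
    -- are separate.
    rcases s.eq_empty_or_nonempty with rfl | hsne
    · simpa [pwm] using ha
    · have h : (fun ω => pwm φ (insert a s) (f ω)) =
          fun ω => max (inner ℝ a (φ (f ω))) (pwm φ s (f ω)) := by
        funext ω
        rw [pwm, Set.image_insert_eq,
          csSup_insert (hs.image _).bddAbove (hsne.image _)]
        rfl
      rw [h]
      exact ha.sup (ih hsne)

end Pwm

/-! ### The upper subdifferential of the refinement objective -/

section Subdiff

variable {E : Type*} [NormedAddCommGroup E] [InnerProductSpace ℝ E]

/-- A regular upper subgradient at a point where a global lower subgradient exists coincides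
with it. -/
lemma IsRegularSubgradient.eq_neg_of_forall_le {f : E → ℝ} {y e w : E}
    (he : IsRegularSubgradient (fun z => -f z) y e)
    (hw : ∀ z, f y + inner ℝ (z - y) w ≤ f z) : e = -w := by
  by_contra hne
  have hv : e + w ≠ 0 := fun h => hne (eq_neg_of_add_eq_zero_left h)
  have hpos : 0 < ‖e + w‖ := norm_pos_iff.2 hv
  -- Along `z = y + t(e + w)` the two subgradient inequalities add up to `t‖e + w‖² ≤ ε t‖e + w‖`,
  -- which fails for `ε = ‖e + w‖ / 2`.
  have htend : Tendsto (fun t : ℝ => y + t • (e + w)) (𝓝[>] 0) (𝓝[≠] y) := by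
    refine tendsto_nhdsWithin_iff.2 ⟨?_, ?_⟩
    · have hc : Continuous fun t : ℝ => y + t • (e + w) := by fun_prop
      simpa using (hc.tendsto 0).mono_left nhdsWithin_le_nhds
    · filter_upwards [self_mem_nhdsWithin] with t ht
      rw [Set.mem_compl_singleton_iff, Ne, add_eq_left]
      exact smul_ne_zero (Set.mem_Ioi.1 ht).ne' hv
  obtain ⟨t, ht, ht0⟩ := ((htend.eventually (he (‖e + w‖ / 2) (half_pos hpos))).and
    self_mem_nhdsWithin).exists
  have ht0 : 0 < t := ht0
  have hz := hw (y + t • (e + w))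
  rw [add_sub_cancel_left] at ht hz
  rw [norm_smul, Real.norm_of_nonneg ht0.le, le_div_iff₀ (mul_pos ht0 hpos)] at ht
  have hsq : inner ℝ (t • (e + w)) e + inner ℝ (t • (e + w)) w = t * (‖e + w‖ * ‖e + w‖) := by
    rw [← inner_add_right, real_inner_smul_left, real_inner_self_eq_norm_mul_norm]
  have : 0 < t * (‖e + w‖ * ‖e + w‖) := by positivity
  linarith

lemma isRegularSubgradient_of_eventually_affine {f : E → ℝ} {y w : E}
    (h : ∀ᶠ z in 𝓝 y, f z = f y + inner ℝ (z - y) w) : IsRegularSubgradient f y w := by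
  intro ε hε
  filter_upwards [nhdsWithin_le_nhds h] with z hz
  rw [hz, add_sub_cancel_left, sub_self, zero_div]
  exact neg_nonpos.2 hε.le

lemma IsLPMax.smul {C : Set E} {d α : E} (h : IsLPMax C d α) {c : ℝ} (hc : 0 ≤ c) :
    IsLPMax C (c • d) α := by
  refine ⟨h.1, fun β hβ => ?_⟩
  rw [real_inner_smul_right, real_inner_smul_right]
  exact mul_le_mul_of_nonneg_left (h.2 β hβ) hc

end Subdiff

/-! ### Affine pieces of the refinement objective -/

section ActiveGrad

variable {X : Type*} {K N : ℕ} (φ : X → EuclideanSpace ℝ (Fin K)) (xc : Fin N → X)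
  (A : Set (EuclideanSpace ℝ (Fin K)))

open Classical in
/-- The sample points at which `α` attains the maximum defining `fpwm`. -/
def activeSet (α : EuclideanSpace ℝ (Fin K)) : Finset (Fin N) :=
  Finset.univ.filter fun i => pwm φ A (xc i) ≤ inner ℝ α (φ (xc i))

/-- The scaled sum of the basis vectors at the sample points in `I`. -/
def sampleGrad (I : Finset (Fin N)) : EuclideanSpace ℝ (Fin K) :=
  (1 / (N : ℝ)) • ∑ i ∈ I, φ (xc i)

variable {φ xc A}

lemma mem_activeSet {α : EuclideanSpace ℝ (Fin K)} {i : Fin N} :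
    i ∈ activeSet φ xc A α ↔ pwm φ A (xc i) ≤ inner ℝ α (φ (xc i)) := by
  simp [activeSet]

/-- Freezing at each sample point the branch of the maximum selected at `y` gives an affine function
of `z`. It supports `fpwm` from below and agrees with it wherever the active set is the same. -/
lemma fpwm_add_inner_sampleGrad (y z : EuclideanSpace ℝ (Fin K)) :
    fpwm φ xc A y + inner ℝ (z - y) (sampleGrad φ xc (activeSet φ xc A y)) =
      (1 / (N : ℝ)) * ∑ i, if i ∈ activeSet φ xc A y then inner ℝ z (φ (xc i))
        else pwm φ A (xc i) := by
  rw [fpwm, sampleGrad, real_inner_smul_right, ← mul_add, inner_sum,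
    ← Finset.sum_ite_mem_eq (activeSet φ xc A y), ← Finset.sum_add_distrib]
  congr 1
  refine Finset.sum_congr rfl fun i _ => ?_
  by_cases hi : i ∈ activeSet φ xc A y
  · rw [if_pos hi, if_pos hi, max_eq_left (mem_activeSet.1 hi), inner_sub_left]
    ring
  · rw [if_neg hi, if_neg hi, max_eq_right (not_le.1 fun h => hi (mem_activeSet.2 h)).le,
      add_zero]

lemma fpwm_add_inner_sampleGrad_le (y z : EuclideanSpace ℝ (Fin K)) :
    fpwm φ xc A y + inner ℝ (z - y) (sampleGrad φ xc (activeSet φ xc A y)) ≤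
      fpwm φ xc A z := by
  rw [fpwm_add_inner_sampleGrad]
  refine mul_le_mul_of_nonneg_left (Finset.sum_le_sum fun i _ => ?_) (by positivity)
  split_ifs
  exacts [le_max_left _ _, le_max_right _ _]

lemma fpwm_eq_of_activeSet_eq {y z : EuclideanSpace ℝ (Fin K)}
    (h : activeSet φ xc A z = activeSet φ xc A y) :
    fpwm φ xc A z =
      fpwm φ xc A y + inner ℝ (z - y) (sampleGrad φ xc (activeSet φ xc A y)) := by
  rw [fpwm_add_inner_sampleGrad, ← h, ← fpwm_add_inner_sampleGrad, sub_self, inner_zero_left,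
    add_zero]

/-- Every upper subgradient of the refinement objective is a scaled sum of basis vectors over a
set of sample points. -/
lemma exists_eq_sampleGrad_of_mem_upperSubdiff {α d : EuclideanSpace ℝ (Fin K)}
    (hd : d ∈ upperSubdiff (fpwm φ xc A) α) : ∃ I : Finset (Fin N), d = sampleGrad φ xc I := by
  obtain ⟨y, e, -, -, he, hlim⟩ := hd
  have hlim' : Tendsto (fun n => -e n) atTop (𝓝 d) := by simpa using hlim.neg
  -- There are only finitely many index sets, so limits of the gradients are again of this form.
  have hclosed : IsClosed (Set.range (sampleGrad φ xc)) := (Set.finite_range _).isClosed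
  obtain ⟨I, hI⟩ := hclosed.mem_of_tendsto hlim' (Eventually.of_forall fun n =>
    ⟨activeSet φ xc A (y n), by
      rw [(he n).eq_neg_of_forall_le (fpwm_add_inner_sampleGrad_le (y n)), neg_neg]⟩)
  exact ⟨I, hI.symm⟩

lemma continuous_fpwm : Continuous (fpwm φ xc A) := by
  unfold fpwm
  fun_prop

lemma eventually_activeSet_eq {y : EuclideanSpace ℝ (Fin K)}
    (hy : ∀ i, inner ℝ y (φ (xc i)) ≠ pwm φ A (xc i)) :
    ∀ᶠ z in 𝓝 y, activeSet φ xc A z = activeSet φ xc A y := by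
  have h : ∀ i, ∀ᶠ z in 𝓝 y, (i ∈ activeSet φ xc A z ↔ i ∈ activeSet φ xc A y) := by
    intro i
    have hc : Continuous fun z : EuclideanSpace ℝ (Fin K) => (inner ℝ z (φ (xc i)) : ℝ) := by
      fun_prop
    simp only [mem_activeSet]
    rcases (hy i).lt_or_gt with hlt | hgt
    · filter_upwards [hc.continuousAt.eventually_lt_const hlt] with z hz
      exact iff_of_false hz.not_ge hlt.not_ge
    · filter_upwards [hc.continuousAt.eventually_const_lt hgt] with z hz
      exact iff_of_true hz.le hgt.le
  filter_upwards [eventually_all.2 h] with z hz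
  exact Finset.ext hz

/-- Along a direction with positive inner product with all the basis vectors, ties are broken in
favour of the active sample points. -/
lemma eventually_activeSet_add_smul {v : EuclideanSpace ℝ (Fin K)}
    (hv : ∀ i, 0 < (inner ℝ v (φ (xc i)) : ℝ)) (α : EuclideanSpace ℝ (Fin K)) :
    ∀ᶠ t : ℝ in 𝓝[>] 0, (∀ i, inner ℝ (α + t • v) (φ (xc i)) ≠ pwm φ A (xc i)) ∧
      activeSet φ xc A (α + t • v) = activeSet φ xc A α := by
  have h : ∀ i, ∀ᶠ t : ℝ in 𝓝[>] 0, inner ℝ (α + t • v) (φ (xc i)) ≠ pwm φ A (xc i) ∧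
      (i ∈ activeSet φ xc A (α + t • v) ↔ i ∈ activeSet φ xc A α) := by
    intro i
    have hc : Continuous fun t : ℝ => (inner ℝ (α + t • v) (φ (xc i)) : ℝ) := by fun_prop
    simp only [mem_activeSet]
    rcases lt_or_ge (inner ℝ α (φ (xc i))) (pwm φ A (xc i)) with hlt | hge
    · have h0 : (inner ℝ (α + (0 : ℝ) • v) (φ (xc i)) : ℝ) < pwm φ A (xc i) := by simpa using hlt
      filter_upwards [nhdsWithin_le_nhds (hc.continuousAt.eventually_lt_const h0)] with t ht
      exact ⟨ht.ne, iff_of_false ht.not_ge hlt.not_ge⟩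
    · filter_upwards [self_mem_nhdsWithin] with t ht
      have hlt : pwm φ A (xc i) < inner ℝ (α + t • v) (φ (xc i)) := by
        rw [inner_add_left, real_inner_smul_left]
        exact lt_add_of_le_of_pos hge (mul_pos ht (hv i))
      exact ⟨hlt.ne', iff_of_true hlt.le hge⟩
  filter_upwards [eventually_all.2 h] with t ht
  exact ⟨fun i => (ht i).1, Finset.ext fun i => (ht i).2⟩

/-- At a kink the convex function `fpwm` has no regular upper subgradient, so the limit is needed:
at the points `α + t • v`, for small `t > 0`, it is locally affine with the active set of `α`, and
the gradients are constant. -/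
lemma sampleGrad_activeSet_mem_upperSubdiff {v : EuclideanSpace ℝ (Fin K)}
    (hv : ∀ i, 0 < (inner ℝ v (φ (xc i)) : ℝ)) (α : EuclideanSpace ℝ (Fin K)) :
    sampleGrad φ xc (activeSet φ xc A α) ∈ upperSubdiff (fpwm φ xc A) α := by
  obtain ⟨t, ht, hact⟩ := exists_seq_forall_of_frequently
    (eventually_activeSet_add_smul (A := A) hv α).frequently
  have hc : Continuous fun t : ℝ => α + t • v := by fun_prop
  have hy : Tendsto (fun n => α + t n • v) atTop (𝓝 α) := by
    simpa [Function.comp_def] using (hc.tendsto 0).comp (ht.mono_right nhdsWithin_le_nhds)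
  refine ⟨fun n => α + t n • v, fun _ => -sampleGrad φ xc (activeSet φ xc A α), hy,
    (continuous_fpwm.neg.tendsto α).comp hy, fun n => ?_, tendsto_const_nhds⟩
  refine isRegularSubgradient_of_eventually_affine ?_
  filter_upwards [eventually_activeSet_eq (hact n).1] with z hz
  rw [fpwm_eq_of_activeSet_eq hz, (hact n).2, inner_neg_right, neg_add]

end ActiveGrad

/-! ### Executions of the algorithm -/

section Execution

variable {X : Type*} {K N : ℕ} (φ : X → EuclideanSpace ℝ (Fin K)) (xc : Fin N → X)
  (BI : Set (EuclideanSpace ℝ (Fin K)) → Set (EuclideanSpace ℝ (Fin K))) (εin εout : ℝ)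
  (Acon : Set (EuclideanSpace ℝ (Fin K))) (V : X → ℝ)

/-- A finite non-empty family whose point-wise maximum is a lower bound of `V`. -/
structure IsLowerFamily (A : Set (EuclideanSpace ℝ (Fin K))) : Prop where
  finite : A.Finite
  nonempty : A.Nonempty
  pwm_le : ∀ x, pwm φ A x ≤ V x

/-- The invariant of the two families maintained by the algorithm. -/
structure ValidFamilies (Ao Ac : Set (EuclideanSpace ℝ (Fin K))) : Prop where
  obj : IsLowerFamily φ V Ao
  con : IsLowerFamily φ V Ac
  subset : Acon ⊆ Ac

/-- The invariant of the program states. -/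
def ValidState : State K → Prop
  | .outer _ Ao Ac => ValidFamilies φ Acon V Ao Ac
  | .sample _ _ i Ao Ac => ValidFamilies φ Acon V Ao Ac ∧ i ≤ N
  | .inner _ _ i Ao Ac _ α => ValidFamilies φ Acon V Ao Ac ∧ i < N ∧ α ∈ BI Ac
  | .update _ _ i Ao Ac _ α d => ValidFamilies φ Acon V Ao Ac ∧ i < N ∧ α ∈ BI Ac ∧
      d ∈ upperSubdiff (fpwm φ xc Ao) α
  | .returned Ao Ac => ValidFamilies φ Acon V Ao Ac

/-- The number of steps of size `ε` that fit between `f` and the average of `V`. -/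
def stepsLeft (ε f : ℝ) : ℕ := ⌊((1 / (N : ℝ)) * ∑ i, V (xc i) - f) / ε⌋₊

/-- The lexicographic termination measure: outer iterations, samples, inner iterations. -/
def rank : State K → ℕ ×ₗ ℕ ×ₗ ℕ
  -- The first entry uses the stored `fm`, hence is constant during a pass over the samples. In the
  -- second, `2N + 2` exceeds the value at sample `0`, and `2(N - i) + 1 > 2(N - i) > 2(N - (i + 1))
  -- + 1` orders the phases. The parity of the third separates `inner` from `update`.
  | .outer _ Ao _ => toLex (stepsLeft xc V εout (avgObj φ xc Ao), toLex (2 * N + 2, 0))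
  | .sample _ fm i _ _ => toLex (stepsLeft xc V εout fm, toLex (2 * (N - i) + 1, 0))
  | .inner _ fm i Ao _ _ α => toLex (stepsLeft xc V εout fm,
      toLex (2 * (N - i), 2 * stepsLeft xc V εin (fpwm φ xc Ao α) + 1))
  | .update _ fm i Ao _ _ α _ => toLex (stepsLeft xc V εout fm,
      toLex (2 * (N - i), 2 * stepsLeft xc V εin (fpwm φ xc Ao α)))
  | .returned _ _ => toLex (0, toLex (0, 0))

variable {φ xc BI εin εout Acon V}

lemma IsLowerFamily.insert {A : Set (EuclideanSpace ℝ (Fin K))} (hA : IsLowerFamily φ V A)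
    {α : EuclideanSpace ℝ (Fin K)} (hα : ∀ x, inner ℝ α (φ x) ≤ V x) :
    IsLowerFamily φ V (insert α A) :=
  ⟨hA.finite.insert α, Set.insert_nonempty _ _,
    fun x => pwm_insert_le hA.finite (hα x) (hA.pwm_le x)⟩

lemma InnerUpdate.mem {C : Set (EuclideanSpace ℝ (Fin K))} {α d α' : EuclideanSpace ℝ (Fin K)}
    (h : InnerUpdate C α d α') (hα : α ∈ C) : α' ∈ C := by
  rcases h with ⟨-, rfl⟩ | ⟨-, h⟩
  exacts [hα, h.1]

lemma ValidState.validFamilies {s : State K} (hs : ValidState φ xc BI Acon V s) :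
    ∃ Ac, ValidFamilies φ Acon V s.Aobj Ac := by
  cases s with
  | outer => exact ⟨_, hs⟩
  | returned => exact ⟨_, hs⟩
  | sample => exact ⟨_, hs.1⟩
  | inner => exact ⟨_, hs.1⟩
  | update => exact ⟨_, hs.1⟩

/-- A gain of `ε` lowers the quotient by at least one, and `hf'` keeps the new quotient
non-negative, so the floor in `ℕ` does not truncate. -/
lemma stepsLeft_lt {ε f f' : ℝ} (hε : 0 < ε) (h : ¬ f' - f < ε)
    (hf' : f' ≤ (1 / (N : ℝ)) * ∑ i, V (xc i)) :
    stepsLeft xc V ε f' < stepsLeft xc V ε f := by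
  unfold stepsLeft
  set B := (1 / (N : ℝ)) * ∑ i, V (xc i)
  refine (Nat.lt_iff_add_one_le).2 (Nat.le_floor ?_)
  push_cast
  have h1 : (⌊(B - f') / ε⌋₊ : ℝ) ≤ (B - f') / ε :=
    Nat.floor_le (div_nonneg (sub_nonneg.2 hf') hε.le)
  rw [le_div_iff₀ hε] at h1 ⊢
  linarith

/-- Only `innerReturn` changes the families. The inserted vector lies in `BI Ac` even if `d = 0`,
since the iterate before it did, and `hlow` applies. -/
lemma ValidState.step
    (hlow : ∀ A, IsLowerFamily φ V A → ∀ α ∈ BI A, ∀ x, inner ℝ α (φ x) ≤ V x)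
    {s s' : State K} (hs : ValidState φ xc BI Acon V s)
    (h : Step φ xc BI εin εout s s') : ValidState φ xc BI Acon V s' := by
  cases h with
  | start => exact ⟨hs, N.zero_le⟩
  | generate _ _ _ _ _ _ hi hα => exact ⟨hs.1, hi, hα.1⟩
  | subgradient _ _ _ _ _ _ _ _ hd => exact ⟨hs.1, hs.2.1, hs.2.2, hd⟩
  | innerRepeat _ _ _ _ _ _ _ _ _ hα => exact ⟨hs.1, hs.2.1, hα.mem hs.2.2.1⟩
  | innerReturn _ _ _ _ _ _ _ _ _ hα =>
    have h := hlow _ hs.1.con _ (hα.mem hs.2.2.1)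
    exact ⟨⟨hs.1.obj.insert h, hs.1.con.insert h,
      hs.1.subset.trans (Set.subset_insert _ _)⟩, hs.2.1⟩
  | outerRepeat => exact hs.1
  | outerReturn => exact hs.1

lemma rank_lt
    (hlow : ∀ A, IsLowerFamily φ V A → ∀ α ∈ BI A, ∀ x, inner ℝ α (φ x) ≤ V x)
    (hεin : 0 < εin) (hεout : 0 < εout) {s s' : State K}
    (hs : ValidState φ xc BI Acon V s) (h : Step φ xc BI εin εout s s') :
    rank φ xc εin εout V s' < rank φ xc εin εout V s := by
  cases h with
  | start => simp [rank, Prod.Lex.toLex_lt_toLex]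
  | generate => simp [rank, Prod.Lex.toLex_lt_toLex]
  | subgradient => simp [rank, Prod.Lex.toLex_lt_toLex]
  | innerRepeat _ _ _ _ _ _ _ _ _ hα hε =>
    have := stepsLeft_lt hεin hε
      (fpwm_le (xc := xc) hs.1.obj.pwm_le (hlow _ hs.1.con _ (hα.mem hs.2.2.1)))
    exact Prod.Lex.toLex_lt_toLex.2 (.inr ⟨rfl, Prod.Lex.toLex_lt_toLex.2
      (.inr ⟨rfl, by dsimp only; omega⟩)⟩)
  | innerReturn =>
    -- `i < N` makes the truncated difference `N - i` really drop.
    have := hs.2.1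
    exact Prod.Lex.toLex_lt_toLex.2 (.inr ⟨rfl, Prod.Lex.toLex_lt_toLex.2
      (.inl (by dsimp only; omega))⟩)
  | outerRepeat _ _ _ _ hε =>
    have := stepsLeft_lt hεout hε (avgObj_le (xc := xc) hs.1.obj.pwm_le)
    exact Prod.Lex.toLex_lt_toLex.2 (.inl this)
  | outerReturn =>
    simp only [rank, Prod.Lex.toLex_lt_toLex]
    omega

lemma not_exists_infinite_execution
    (hlow : ∀ A, IsLowerFamily φ V A → ∀ α ∈ BI A, ∀ x, inner ℝ α (φ x) ≤ V x)
    (hεin : 0 < εin) (hεout : 0 < εout) {s₀ : State K}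
    (h₀ : ValidState φ xc BI Acon V s₀) :
    ¬ ∃ s : ℕ → State K, s 0 = s₀ ∧ ∀ n, Step φ xc BI εin εout (s n) (s (n + 1)) := by
  rintro ⟨s, rfl, hs⟩
  have hvalid : ∀ n, ValidState φ xc BI Acon V (s n) := fun n => by
    induction n with
    | zero => exact h₀
    | succ n ih => exact ih.step hlow (hs n)
  exact not_strictAnti_of_wellFoundedLT (fun n => rank φ xc εin εout V (s n))
    (strictAnti_nat_of_succ_lt fun n => rank_lt hlow hεin hεout (hvalid n) (hs n))

lemma Reachable.validState
    (hlow : ∀ A, IsLowerFamily φ V A → ∀ α ∈ BI A, ∀ x, inner ℝ α (φ x) ≤ V x)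
    {Aobj : Set (EuclideanSpace ℝ (Fin K))} {s : State K}
    (h₀ : ValidFamilies φ Acon V Aobj Acon)
    (hs : Reachable φ xc BI εin εout Aobj Acon s) : ValidState φ xc BI Acon V s := by
  induction hs with
  | refl => exact h₀
  | tail _ h ih => exact ih.step hlow h

lemma avgObj_le_of_step
    (hlow : ∀ A, IsLowerFamily φ V A → ∀ α ∈ BI A, ∀ x, inner ℝ α (φ x) ≤ V x)
    {s s' : State K} (hs : ValidState φ xc BI Acon V s)
    (h : Step φ xc BI εin εout s s') : avgObj φ xc s.Aobj ≤ avgObj φ xc s'.Aobj := by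
  obtain ⟨_, hv⟩ := hs.validFamilies
  obtain ⟨_, hv'⟩ := (hs.step hlow h).validFamilies
  refine avgObj_mono hv.obj.nonempty hv'.obj.finite ?_
  cases h with
  | innerReturn => exact Set.subset_insert _ _
  | _ => exact subset_rfl

/-- A valid state at which no step is possible is a returned one, or a refinement program
without a maximizer. -/
lemma exists_step_or_returned_or_no_maximizer
    {v : EuclideanSpace ℝ (Fin K)} (hv : ∀ i, 0 < (inner ℝ v (φ (xc i)) : ℝ))
    (hLP : ∀ A, Acon ⊆ A → IsLowerFamily φ V A → ∀ i, ∃ α, IsLPMax (BI A) (φ (xc i)) α)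
    {s : State K} (hs : ValidState φ xc BI Acon V s) :
    (∃ s', Step φ xc BI εin εout s s') ∨ (∃ Ao Ac, s = State.returned Ao Ac) ∨
      (∃ m fm i Ao Ac k α d, s = State.update m fm i Ao Ac k α d ∧ d ≠ 0 ∧
        ¬ ∃ β, IsLPMax (BI Ac) d β) := by
  cases s with
  | outer m Ao Ac => exact .inl ⟨_, .start m Ao Ac⟩
  | returned Ao Ac => exact .inr (.inl ⟨Ao, Ac, rfl⟩)
  | sample m fm i Ao Ac =>
    left
    rcases hs.2.lt_or_eq with hi | rfl
    · obtain ⟨α, hα⟩ := hLP Ac hs.1.subset hs.1.con ⟨i, hi⟩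
      exact ⟨_, .generate m fm i Ao Ac α hi hα⟩
    · by_cases hε : avgObj φ xc Ao - fm < εout
      · exact ⟨_, .outerReturn m fm Ao Ac hε⟩
      · exact ⟨_, .outerRepeat m fm Ao Ac hε⟩
  | inner m fm i Ao Ac k α =>
    exact .inl ⟨_, .subgradient m fm i Ao Ac k α _ (sampleGrad_activeSet_mem_upperSubdiff hv α)⟩
  | update m fm i Ao Ac k α d =>
    by_cases h : d ≠ 0 ∧ ¬ ∃ β, IsLPMax (BI Ac) d β
    · exact .inr (.inr ⟨m, fm, i, Ao, Ac, k, α, d, rfl, h⟩)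
    · left
      obtain ⟨α', hα'⟩ : ∃ α', InnerUpdate (BI Ac) α d α' := by
        by_cases hd : d = 0
        · exact ⟨α, .inl ⟨hd, rfl⟩⟩
        · obtain ⟨β, hβ⟩ := not_not.1 fun h' => h ⟨hd, h'⟩
          exact ⟨β, .inr ⟨hd, hβ⟩⟩
      by_cases hε : fpwm φ xc Ao α' - fpwm φ xc Ao α < εin
      · exact ⟨_, .innerReturn m fm i Ao Ac k α d α' hα' hε⟩
      · exact ⟨_, .innerRepeat m fm i Ao Ac k α d α' hα' hε⟩

/-- Such a `d` is a non-negative multiple of a sum over some `I`, non-empty because `d ≠ 0`, and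
this scaling preserves maximizers. -/
lemma exists_isLPMax_of_mem_upperSubdiff {A C : Set (EuclideanSpace ℝ (Fin K))}
    (hC : ∀ I : Finset (Fin N), I.Nonempty → ∃ α, IsLPMax C (∑ i ∈ I, φ (xc i)) α)
    {α d : EuclideanSpace ℝ (Fin K)} (hd : d ∈ upperSubdiff (fpwm φ xc A) α) (hd0 : d ≠ 0) :
    ∃ β, IsLPMax C d β := by
  obtain ⟨I, rfl⟩ := exists_eq_sampleGrad_of_mem_upperSubdiff hd
  have hI : I.Nonempty := by
    rw [Finset.nonempty_iff_ne_empty]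
    rintro rfl
    simp [sampleGrad] at hd0
  obtain ⟨β, hβ⟩ := hC I hI
  exact ⟨β, hβ.smul (by positivity)⟩

end Execution

end PwmADP

end

open PwmADP in
theorem mainTheorem3 {nx nu nξ K N : ℕ} (M : ControlProblem nx nu nξ)
    -- the optimal value function is real-valued
    (hfin : ∀ x, M.optCost x ≠ ⊤)
    -- continuous basis functions, including the constant, with well-defined expectations
    (φ : M.X → EuclideanSpace ℝ (Fin K))
    (hφ_cont : Continuous φ)
    (hφ_const : ∃ k, ∀ x, φ x k = 1)
    (hφ_int : ∀ x u, Integrable (fun ξ => φ (M.g x u ξ)) M.P)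
    (BI : Set (EuclideanSpace ℝ (Fin K)) → Set (EuclideanSpace ℝ (Fin K)))
    (hBI : IsConvexInnerApprox M φ BI)
    (hN : 0 < N) (xc : Fin N → M.X)
    (Aobj Acon : Set (EuclideanSpace ℝ (Fin K)))
    (hobj_fin : Aobj.Finite) (hobj_ne : Aobj.Nonempty)
    (hcon_fin : Acon.Finite) (hcon_ne : Acon.Nonempty)
    (hobj : ∀ x, pwm φ Aobj x ≤ M.Vstar x)
    (hcon : ∀ x, pwm φ Acon x ≤ M.Vstar x)
    -- the linear program at each sample point attains its maximum
    (hLP : ∀ A : Set (EuclideanSpace ℝ (Fin K)), Acon ⊆ A → A.Finite →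
      (∀ x, pwm φ A x ≤ M.Vstar x) → ∀ i, ∃ α, IsLPMax (BI A) (φ (xc i)) α)
    (εin εout : ℝ) (hεin : 0 < εin) (hεout : 0 < εout) :
    -- no execution is infinite
    (¬ ∃ s : ℕ → State K, s 0 = State.outer 0 Aobj Acon ∧
      ∀ n, Step φ xc BI εin εout (s n) (s (n + 1))) ∧
    -- the objective is non-decreasing and bounded above by the average of the value function
    (∀ s, Reachable φ xc BI εin εout Aobj Acon s →
      avgObj φ xc s.Aobj ≤ (1 / (N : ℝ)) * ∑ i, M.Vstar (xc i) ∧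
      ∀ s', Step φ xc BI εin εout s s' → avgObj φ xc s.Aobj ≤ avgObj φ xc s'.Aobj) ∧
    -- an execution stops only by returning, or at a refinement program without a maximizer
    (∀ s, Reachable φ xc BI εin εout Aobj Acon s →
      (∃ s', Step φ xc BI εin εout s s') ∨ (∃ Ao Ac, s = State.returned Ao Ac) ∨
      (∃ m fm i Ao Ac k α d, s = State.update m fm i Ao Ac k α d ∧ d ≠ 0 ∧
        ¬ ∃ β, IsLPMax (BI Ac) d β)) ∧
    -- if the programs for sums over sample points are attained, executions stop only by returning
    ((∀ A : Set (EuclideanSpace ℝ (Fin K)), Acon ⊆ A → A.Finite →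
        (∀ x, pwm φ A x ≤ M.Vstar x) → ∀ I : Finset (Fin N), I.Nonempty →
        ∃ α, IsLPMax (BI A) (∑ i ∈ I, φ (xc i)) α) →
      ∀ s, Reachable φ xc BI εin εout Aobj Acon s →
        (∃ s', Step φ xc BI εin εout s s') ∨ ∃ Ao Ac, s = State.returned Ao Ac) := by
  have hlow : ∀ A, IsLowerFamily φ M.Vstar A → ∀ α ∈ BI A, ∀ x, inner ℝ α (φ x) ≤ M.Vstar x :=
    fun A hA α hα => M.le_Vstar_of_le_bellman hfin hA.pwm_le
      (fun x u => integrable_pwm (hφ_int x u) hA.finite hA.nonempty)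
      (hBI.bellman_ineq A hA.finite hA.nonempty α hα)
  have h₀ : ValidFamilies φ Acon M.Vstar Aobj Acon :=
    ⟨⟨hobj_fin, hobj_ne, hobj⟩, ⟨hcon_fin, hcon_ne, hcon⟩, subset_rfl⟩
  have hvalid : ∀ {s}, Reachable φ xc BI εin εout Aobj Acon s →
      ValidState φ xc BI Acon M.Vstar s := fun hs => hs.validState hlow h₀
  obtain ⟨k, hk⟩ := hφ_const
  -- The coordinate vector of the constant basis function has inner product `1` with every `φ(xcᵢ)`;
  -- it is the tie-breaking direction.
  have hv : ∀ i, 0 < (inner ℝ (EuclideanSpace.single k (1 : ℝ)) (φ (xc i)) : ℝ) := fun i => by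
    simp [EuclideanSpace.inner_single_left, hk]
  have hprogress : ∀ s, Reachable φ xc BI εin εout Aobj Acon s → _ := fun s hs =>
    exists_step_or_returned_or_no_maximizer (εin := εin) (εout := εout) hv
      (fun A hsub hA => hLP A hsub hA.finite hA.pwm_le) (hvalid hs)
  refine ⟨not_exists_infinite_execution hlow hεin hεout h₀, fun s hs => ⟨?_, fun s' h => ?_⟩,
    hprogress, fun hsum s hs => ?_⟩
  · obtain ⟨_, h⟩ := (hvalid hs).validFamilies
    exact avgObj_le h.obj.pwm_le
  · exact avgObj_le_of_step hlow (hvalid hs) h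
  · rcases hprogress s hs with h | h | ⟨m, fm, i, Ao, Ac, j, α, d, rfl, hd0, hd⟩
    · exact .inl h
    · exact .inr h
    · obtain ⟨hF, -, -, hmem⟩ := hvalid hs
      exact absurd (exists_isLPMax_of_mem_upperSubdiff
        (hsum Ac hF.subset hF.con.finite hF.con.pwm_le) hmem hd0) hd
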